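/- Let $r\ge 0$, let $\mathbb{R}^d$ carry an arbitrary norm $|\cdot|$, and let $\mathcal{C}=\mathcal{C}([-r,0],\mathbb{R}^d)$ be the Banach space of continuous functions from $[-r,0]$ to $\mathbb{R}^d$ with the norm $\|\psi\|=\sup_{\theta\in[-r,0]}|\psi(\theta)|$. For a continuous function $x$ that is defined on $[t-r,t]$, let $x_t\in\mathcal{C}$ be given by $x_t(\theta)=x(t+\theta)$. A solution of an initial value problem $\dot x(t)=g(t,x_t)$, $x_0=\phi$, with $\phi\in\mathcal{C}$, is a continuous function $x:I\to\mathbb{R}^d$ on an interval $I\subseteq[-r,\infty)$ that contains $[-r,0]$ and a positive number, such that $x_0=\phi$ and $\dot x(t)=g(t,x_t)$ for all $t\in I$ with $t\ge 0$ (one-sided derivatives at $0$ and at the right end point of $I$, if it belongs to $I$). A solution is maximal if it is not the restriction of a solution on a strictly larger interval. The problem has a unique solution if it has a solution and any two of its solutions coincide wherever both are defined. Let $f:\mathbb{R}_+\times\mathcal{C}\to\mathbb{R}^d$, $(t,\psi)\mapsto f(t,\psi)$, be a continuous function, where $\mathbb{R}_+=[0,\infty)$, and let $\phi\in\mathcal{C}$.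 Suppose that: (H1) $f$ is continuous in the second variable uniformly with respect to the first one: for all $\psi\in\mathcal{C}$ and $\eta>0$ there is $\rho>0$ such that $|f(t,\psi')-f(t,\psi)|<\eta$ for all $\psi'\in\mathcal{C}$ with $\|\psi'-\psi\|<\rho$ and all $t\in\mathbb{R}_+$; (H2) for every bounded subset $B$ of $\mathcal{C}$, $f$ is bounded on $\mathbb{R}_+\times B$; (H3) for all $\psi\in\mathcal{C}$ the limit $F(\psi):=\lim_{T\to\infty}\frac1T\int_0^T f(t,\psi)\,dt$ exists; (H6) the averaged initial value problem $\dot y(t)=F(y_t)$, $y_0=\phi$, has a unique solution. Let $y:J\to\mathbb{R}^d$ be the maximal solution of the averaged problem and let $L\in J$ be positive. Then for every $\delta>0$ there exists $\varepsilon_0=\varepsilon_0(L,\delta)>0$ such that, for all $\varepsilon\in(0,\varepsilon_0]$, every maximal solution $x$ of $$\dot x(t)=f(t/\varepsilon,x_t),\qquad x_0=\phi,$$ is defined at least on $[-r,L]$ and satisfies $|x(t)-y(t)|<\delta$ for all $t\in[0,L]$. -/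

import Mathlib

open Set Filter Topology

noncomputable section

namespace RFDE

variable {E : Type*} [NormedAddCommGroup E] [NormedSpace ℝ E]

/-- The history `x_t` of `x` at time `t`: the element `θ ↦ x (t + θ)` of `C([-r, 0], E)`.
It takes the default value `0` only when this map is not continuous on `[-r, 0]`, which never
happens at the times at which the differential equation below is required to hold. -/
def history (r : ℝ) (x : ℝ → E) (t : ℝ) : C(Icc (-r) 0, E) :=
  ContinuousMap.mkD (fun θ : Icc (-r) 0 => x (t + θ)) 0

/-- `x : I → E` solves the initial value problem `x'(t) = g(t, x_t)`, `x_0 = φ`.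
Here `I` is an interval with left end point `-r` (included) that contains `[-r, 0]` and some
positive time, and only the values of `x` on `I` matter. The derivative is taken within
`I ∩ [0, ∞)`: it is the right derivative at `0`, the left derivative at the right end point of
`I` if that belongs to `I`, and the ordinary derivative in between. -/
structure IsSolution (r : ℝ) (g : ℝ → C(Icc (-r) 0, E) → E) (φ : C(Icc (-r) 0, E))
    (I : Set ℝ) (x : ℝ → E) : Prop where
  ordConnected : I.OrdConnected
  subset_Ici : I ⊆ Ici (-r)
  Icc_subset : Icc (-r) 0 ⊆ I
  exists_pos : ∃ t ∈ I, 0 < t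
  continuousOn : ContinuousOn x I
  initial : ∀ θ : Icc (-r) 0, x θ = φ θ
  hasDerivWithinAt : ∀ t ∈ I, 0 ≤ t → HasDerivWithinAt x (g t (history r x t)) (I ∩ Ici 0) t

/-- A maximal (noncontinuable) solution: one that is not the restriction of a solution on a
strictly larger interval. -/
def IsMaximalSolution (r : ℝ) (g : ℝ → C(Icc (-r) 0, E) → E) (φ : C(Icc (-r) 0, E))
    (I : Set ℝ) (x : ℝ → E) : Prop :=
  IsSolution r g φ I x ∧
    ∀ (I' : Set ℝ) (x' : ℝ → E), IsSolution r g φ I' x' → I ⊆ I' → EqOn x' x I → I' = I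

/-- The initial value problem has a unique solution: there is a solution, and any two solutions
coincide wherever both are defined. -/
def HasUniqueSolution (r : ℝ) (g : ℝ → C(Icc (-r) 0, E) → E) (φ : C(Icc (-r) 0, E)) : Prop :=
  (∃ (I : Set ℝ) (x : ℝ → E), IsSolution r g φ I x) ∧
    ∀ (I₁ I₂ : Set ℝ) (x₁ x₂ : ℝ → E),
      IsSolution r g φ I₁ x₁ → IsSolution r g φ I₂ x₂ → EqOn x₁ x₂ (I₁ ∩ I₂)

end RFDE

end

/-!
The proof is by compactness and contradiction. A solution `x` of the rescaled equation whose
parameter `ε` is small and which violates the conclusion must leave the `δ`-neighbourhood of `y` at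
some first time `τ ≤ L`: otherwise it is bounded up to `L`, and a bounded maximal solution continues
up to `L` (`IsMaximalSolution.Icc_subset_of_bounded`). The continuation needs Peano's theorem for
functional differential equations (`exists_integral_eq_of_continuousOn`), which is obtained from the
Arzelà–Ascoli theorem by giving the equation an additional small delay, so that it can be solved
step by step.

For parameters `ε n → 0` the solutions stopped at their exit times `τ n` are equibounded and, since
`f` is bounded on bounded sets, equi-Lipschitz. Hence a subsequence converges uniformly to some `Z`,
with `τ n → T`. The integral form of the equation passes to the limit: the integrals of
`f (s / ε n)` along the histories of the solutions tend to that of `F` along the histories of `Z`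
(`tendsto_integral_rescaled_of_tendsto`). To see this, the histories are first replaced by those of
`Z`, by continuity of `f` uniformly in time and dominated convergence; along the fixed continuous
curve of histories of `Z`, which is almost constant on short intervals, the definition of `F`
applies. So `Z` solves the averaged problem on `[-r, T]`, and coincides with `y` there by
uniqueness. But `‖Z T - y T‖ = δ` is the limit of `‖x (τ n) - y (τ n)‖ = δ`, a contradiction.
-/

namespace RFDE

/-! ### Histories and the integral form of the equation -/

section History

variable {E : Type*} [NormedAddCommGroup E] {r : ℝ}

theorem history_apply {X : ℝ → E} (hX : Continuous X) (t : ℝ) (θ : Icc (-r) 0) :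
    history r X t θ = X (t + θ) :=
  ContinuousMap.mkD_apply_of_continuous (f := fun θ : Icc (-r) 0 => X (t + θ)) (by fun_prop)

theorem history_congr {x X : ℝ → E} {t : ℝ} (h : EqOn x X (Icc (t - r) t)) :
    history r x t = history r X t := by
  have : (fun θ : Icc (-r) 0 => x (t + θ)) = fun θ : Icc (-r) 0 => X (t + θ) := by
    funext θ
    have := θ.2.1
    have := θ.2.2
    exact h ⟨by linarith, by linarith⟩
  rw [history, history, this]

theorem continuous_history {X : ℝ → E} (hX : Continuous X) : Continuous (history r X) := by
  have : history r X =
      (ContinuousMap.mk (fun p : ℝ × Icc (-r) 0 => X (p.1 + p.2)) (by fun_prop)).curry := by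
    funext t
    ext θ
    simp [history_apply hX]
  rw [this]
  exact ContinuousMap.continuous _

theorem norm_history_le {X : ℝ → E} (hX : Continuous X) {R : ℝ} (hR : 0 ≤ R)
    (h : ∀ t, ‖X t‖ ≤ R) (t : ℝ) : ‖history r X t‖ ≤ R :=
  (ContinuousMap.norm_le _ hR).2 fun θ => by rw [history_apply hX]; exact h _

/-- Histories depend continuously on the function, for uniform convergence, and on the time. -/
theorem tendsto_history {X : ℕ → ℝ → E} {X₀ : ℝ → E} (hX : ∀ n, Continuous (X n))
    (hX₀ : Continuous X₀) (h : TendstoUniformly X X₀ atTop) {t : ℕ → ℝ} {t₀ : ℝ}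
    (ht : Tendsto t atTop (𝓝 t₀)) :
    Tendsto (fun n => history r (X n) (t n)) atTop (𝓝 (history r X₀ t₀)) := by
  rw [Metric.tendsto_atTop']
  intro η hη
  obtain ⟨N₁, hN₁⟩ := eventually_atTop.1 (Metric.tendstoUniformly_iff.1 h (η / 2) (by positivity))
  obtain ⟨N₂, hN₂⟩ := (Metric.tendsto_atTop'.1
    (((continuous_history (r := r) hX₀).tendsto t₀).comp ht)) (η / 2) (by positivity)
  refine ⟨max N₁ N₂, fun n hn => ?_⟩
  have h₁ : dist (history r (X n) (t n)) (history r X₀ (t n)) ≤ η / 2 := by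
    refine (ContinuousMap.dist_le (by positivity)).2 fun θ => ?_
    rw [history_apply (hX n), history_apply hX₀, dist_comm]
    exact (hN₁ n ((le_max_left _ _).trans hn.le) _).le
  have h₂ := hN₂ n ((le_max_right _ _).trans_lt hn)
  have := dist_triangle (history r (X n) (t n)) (history r X₀ (t n)) (history r X₀ t₀)
  simp only [Function.comp] at h₂
  linarith

theorem continuousOn_comp_history {g : ℝ → C(Icc (-r) 0, E) → E}
    (hg : ContinuousOn (Function.uncurry g) (Ici 0 ×ˢ univ)) {H : ℝ → C(Icc (-r) 0, E)}
    (hH : Continuous H) : ContinuousOn (fun s => g s (H s)) (Ici 0) :=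
  hg.comp (f := fun s : ℝ => (s, H s)) (by fun_prop) fun s hs => ⟨hs, mem_univ _⟩

theorem intervalIntegrable_of_continuousOn_Ici {k : ℝ → E} (hk : ContinuousOn k (Ici 0))
    {a b : ℝ} (ha : 0 ≤ a) (hb : 0 ≤ b) : IntervalIntegrable k MeasureTheory.volume a b :=
  (hk.mono fun _ hs => (le_min ha hb).trans hs.1).intervalIntegrable

variable [NormedSpace ℝ E] [CompleteSpace E] {g : ℝ → C(Icc (-r) 0, E) → E} {φ : C(Icc (-r) 0, E)}

theorem isSolution_of_integral_eq (hr : 0 ≤ r)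
    (hg : ContinuousOn (Function.uncurry g) (Ici 0 ×ˢ univ)) {X : ℝ → E} (hX : Continuous X)
    {b : ℝ} (hb : 0 < b) (hφ : ∀ θ : Icc (-r) 0, X θ = φ θ)
    (h : ∀ t ∈ Icc 0 b, X t = X 0 + ∫ s in (0 : ℝ)..t, g s (history r X s)) :
    IsSolution r g φ (Icc (-r) b) X := by
  refine ⟨ordConnected_Icc, Icc_subset_Ici_self, Icc_subset_Icc_right hb.le,
    ⟨b, ⟨by linarith, le_rfl⟩, hb⟩, hX.continuousOn, hφ, fun t ht ht0 => ?_⟩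
  have hk := continuousOn_comp_history hg (continuous_history (r := r) hX)
  -- a continuous extension of the integrand to negative times
  set k : ℝ → E := fun s => g (max s 0) (history r X (max s 0)) with hkdef
  have hkc : Continuous k :=
    hk.comp_continuous (by fun_prop : Continuous fun s : ℝ => max s 0)
      fun s => mem_Ici.2 (le_max_right _ _)
  have hd : HasDerivAt (fun u => X 0 + ∫ s in (0 : ℝ)..u, k s) (k t) t :=
    (hkc.integral_hasStrictDerivAt 0 t).hasDerivAt.const_add _
  have hkt : k t = g t (history r X t) := by simp [hkdef, ht0]
  have heq : ∀ u ∈ Icc 0 b, X u = X 0 + ∫ s in (0 : ℝ)..u, k s := fun u hu => by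
    rw [h u hu]
    congr 1
    refine intervalIntegral.integral_congr fun s hs => ?_
    rw [uIcc_of_le hu.1] at hs
    simp [hkdef, hs.1]
  rw [← hkt]
  exact hd.hasDerivWithinAt.congr (fun u hu => heq u ⟨hu.2, hu.1.2⟩) (heq t ⟨ht0, ht.2⟩)

theorem IsSolution.integral_eq {I : Set ℝ} {x : ℝ → E} (hx : IsSolution r g φ I x)
    (hg : ContinuousOn (Function.uncurry g) (Ici 0 ×ˢ univ)) {X : ℝ → E} (hX : Continuous X)
    {T : ℝ} (hT : Icc (-r) T ⊆ I) (hxX : EqOn x X (Icc (-r) T)) (hr : 0 ≤ r) {t : ℝ}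
    (ht : t ∈ Icc 0 T) : X t = X 0 + ∫ s in (0 : ℝ)..t, g s (history r X s) := by
  have hk := continuousOn_comp_history hg (continuous_history (r := r) hX)
  rw [intervalIntegral.integral_eq_sub_of_hasDeriv_right (f := X) hX.continuousOn]
  · abel
  · intro s hs
    rw [min_eq_left ht.1, max_eq_right ht.1] at hs
    have hsT : s < T := hs.2.trans_le ht.2
    have hI : I ∩ Ici 0 ∈ 𝓝 s := by
      filter_upwards [Ioo_mem_nhds hs.1 hsT] with u hu
      exact ⟨hT ⟨by linarith [hu.1], hu.2.le⟩, hu.1.le⟩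
    have hd := (hx.hasDerivWithinAt s (mem_of_mem_nhds hI).1 hs.1.le).hasDerivAt hI
    have hXx : X =ᶠ[𝓝 s] x := by
      filter_upwards [Ioo_mem_nhds hs.1 hsT] with u hu
      exact (hxX ⟨by linarith [hu.1], hu.2.le⟩).symm
    have hh : history r x s = history r X s :=
      history_congr fun u hu => hxX ⟨by linarith [hu.1, hs.1], hu.2.trans hsT.le⟩
    rw [← hh]
    exact (hd.congr_of_eventuallyEq hXx).hasDerivWithinAt
  · exact intervalIntegrable_of_continuousOn_Ici hk le_rfl ht.1

end History

/-! ### Compactness -/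

section Compactness

variable {E : Type*} [NormedAddCommGroup E] [NormedSpace ℝ E] [FiniteDimensional ℝ E]

/-- A form of the Arzelà–Ascoli theorem: functions that coincide before `a`, are equi-Lipschitz on
`[a, b]` and constant after `b` have a subsequence that converges uniformly on `ℝ`. -/
theorem exists_tendstoUniformly_subseq {a b M : ℝ} (hab : a ≤ b) {X₀ : ℝ → E}
    {X : ℕ → ℝ → E} (hX : ∀ n, Continuous (X n)) (hpre : ∀ n, ∀ t ≤ a, X n t = X₀ t)
    (hlip : ∀ n, ∀ s ∈ Icc a b, ∀ t ∈ Icc a b, ‖X n s - X n t‖ ≤ M * |s - t|)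
    (hpost : ∀ n, ∀ t, b ≤ t → X n t = X n b) :
    ∃ (Y : ℝ → E) (σ : ℕ → ℕ), StrictMono σ ∧ Continuous Y ∧
      TendstoUniformly (fun n => X (σ n)) Y atTop := by
  have hM : ∀ n, ∀ s ∈ Icc a b, ∀ t ∈ Icc a b, ‖X n s - X n t‖ ≤ |M| * |s - t| :=
    fun n s hs t ht => (hlip n s hs t ht).trans (by gcongr; exact le_abs_self M)
  let Z : ℕ → BoundedContinuousFunction (Icc a b) E := fun n =>
    BoundedContinuousFunction.mkOfCompact ⟨fun t => X n t, (hX n).comp continuous_subtype_val⟩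
  have hZ : ∀ n t, Z n t = X n t := fun n t => rfl
  have hcomp : IsCompact (closure (range Z)) := by
    have := FiniteDimensional.proper_real E
    refine BoundedContinuousFunction.arzela_ascoli
      (Metric.closedBall (X₀ a) (|M| * (b - a))) (isCompact_closedBall _ _) _ ?_ ?_
    · rintro _ t ⟨n, rfl⟩
      rw [mem_closedBall_iff_norm, hZ, ← hpre n a le_rfl]
      refine (hM n t t.2 a ⟨le_rfl, hab⟩).trans ?_
      gcongr
      rw [abs_of_nonneg (by linarith [t.2.1])]
      linarith [t.2.2]
    · refine Metric.equicontinuous_of_continuity_modulus (fun d => |M| * d) ?_ _ ?_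
      · exact Continuous.tendsto' (by fun_prop) _ _ (by simp)
      · rintro s t ⟨_, n, rfl⟩
        rw [dist_eq_norm]
        exact hM n s s.2 t t.2
  obtain ⟨z, -, σ, hσ, hlim⟩ := hcomp.tendsto_subseq fun n => subset_closure (mem_range_self n)
  have hunif := BoundedContinuousFunction.tendsto_iff_tendstoUniformly.1 hlim
  have hza : z ⟨a, le_rfl, hab⟩ = X₀ a := by
    refine tendsto_nhds_unique (hunif.tendsto_at _) ?_
    simp [hZ, hpre]
  -- the value at `t` is that at the projection of `t` to `[a, b]`, plus a correction before `a`
  have hform : ∀ n t, X n t = Z n (projIcc a b hab t) + (X₀ (min t a) - X₀ a) := by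
    intro n t
    rw [hZ]
    rcases le_total t a with h | h
    · rw [projIcc_of_le_left _ h, min_eq_left h, hpre n t h, hpre n a le_rfl]
      abel
    · rw [min_eq_right h, sub_self, add_zero]
      rcases le_total t b with h' | h'
      · rw [projIcc_of_mem hab ⟨h, h'⟩]
      · rw [projIcc_of_right_le _ h', hpost n t h']
  have hX₀ : Continuous fun t => X₀ (min t a) := by
    have : (fun t => X₀ (min t a)) = fun t => X 0 (min t a) :=
      funext fun t => (hpre 0 _ (min_le_right _ _)).symm
    rw [this]
    exact (hX 0).comp (by fun_prop)
  refine ⟨fun t => z (projIcc a b hab t) + (X₀ (min t a) - X₀ a), σ, hσ, ?_, ?_⟩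
  · exact (z.continuous.comp continuous_projIcc).add (hX₀.sub continuous_const)
  · rw [Metric.tendstoUniformly_iff] at hunif ⊢
    intro η hη
    filter_upwards [hunif η hη] with n hn t
    rw [hform, dist_add_right]
    exact hn _

end Compactness

/-! ### Local existence -/

section Existence

variable {E : Type*} [NormedAddCommGroup E] {r : ℝ}
  {g : ℝ → C(Icc (-r) 0, E) → E}

theorem continuous_comp_history (hg : Continuous (Function.uncurry g)) {X : ℝ → E}
    (hX : Continuous X) (h : ℝ) : Continuous fun s => g s (history r X (s - h)) := by
  have hH : Continuous fun s => history r X (s - h) :=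
    (continuous_history hX).comp (by fun_prop)
  exact hg.comp (by fun_prop : Continuous fun s : ℝ => (s, history r X (s - h)))

variable [NormedSpace ℝ E]

/-- The Picard operator of `x'(t) = g(t, x_{t-h})` on `[b, c]` with the function `X₀` prescribed
before `b`. Its values are constant after `c`, so that they are defined on all of `ℝ`. -/
noncomputable def delayedPicard (r : ℝ) (g : ℝ → C(Icc (-r) 0, E) → E) (X₀ : ℝ → E) (b c h : ℝ)
    (x : ℝ → E) (t : ℝ) : E :=
  X₀ (min t b) + ∫ s in b..max b (min t c), g s (history r x (s - h))

/-- Delayed equations have solutions: every application of the Picard operator determines the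
solution on a further interval of length `h`, so that finitely many reach `c`. -/
theorem exists_delayed_solution (hg : Continuous (Function.uncurry g)) {X₀ : ℝ → E}
    (hX₀ : Continuous X₀) {b c R M : ℝ} (hbc : b ≤ c) (hR : ∀ t, ‖X₀ t‖ ≤ R - 1)
    (hM : ∀ t ψ, ‖ψ‖ ≤ R → ‖g t ψ‖ ≤ M) (hcM : M * (c - b) ≤ 1) {h : ℝ} (hh : 0 < h) :
    ∃ X : ℝ → E, Continuous X ∧ (∀ t, ‖X t‖ ≤ R) ∧ (∀ t ≤ b, X t = X₀ t) ∧
      (∀ t, c ≤ t → X t = X c) ∧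
      ∀ t ∈ Icc b c, X t = X₀ b + ∫ s in b..t, g s (history r X (s - h)) := by
  have hR0 : 0 ≤ R := by linarith [norm_nonneg (X₀ 0), hR 0]
  have hM0 : 0 ≤ M := (norm_nonneg _).trans (hM 0 0 (by simpa using hR0))
  let Φ := delayedPicard r g X₀ b c h
  let x : ℕ → ℝ → E := fun k => Φ^[k] X₀
  have hsucc : ∀ k, x (k + 1) = Φ (x k) := fun k => Function.iterate_succ_apply' _ _ _
  have hx : ∀ k, Continuous (x k) ∧ ∀ t, ‖x k t‖ ≤ R := by
    intro k
    induction k with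
    | zero => exact ⟨hX₀, fun t => (hR t).trans (by linarith)⟩
    | succ k ih =>
      rw [hsucc]
      have hk := continuous_comp_history hg ih.1 h
      refine ⟨?_, fun t => ?_⟩
      · exact (hX₀.comp (by fun_prop)).add
          ((intervalIntegral.continuous_primitive (fun _ _ => hk.intervalIntegrable _ _) b).comp
            (by fun_prop))
      · have h1 := intervalIntegral.norm_integral_le_of_norm_le_const (a := b)
          (b := max b (min t c)) (f := fun s => g s (history r (x k) (s - h))) (C := M)
          fun s _ => hM _ _ (norm_history_le ih.1 hR0 ih.2 _)
        have h2 : |max b (min t c) - b| ≤ c - b := by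
          rw [abs_of_nonneg (by linarith [le_max_left b (min t c)])]
          linarith [max_le hbc (min_le_right t c)]
        have h3 := mul_le_mul_of_nonneg_left h2 hM0
        refine (norm_add_le _ _).trans ?_
        linarith [hR (min t b)]
  have hpre : ∀ k, ∀ t ≤ b, Φ (x k) t = X₀ t := by
    intro k t ht
    simp [Φ, delayedPicard, ht]
  -- the `k`-th iterate is final up to time `b + k * h`
  have hstep : ∀ k : ℕ, ∀ t ≤ b + k * h, x (k + 1) t = x k t := by
    intro k
    induction k with
    | zero =>
      intro t ht
      rw [hsucc, hpre 0 t (by simpa using ht)]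
      rfl
    | succ k ih =>
      intro t ht
      rw [hsucc (k + 1)]
      conv_rhs => rw [hsucc k]
      refine congrArg (X₀ (min t b) + ·) (intervalIntegral.integral_congr fun s hs => ?_)
      rw [uIcc_of_le (le_max_left _ _)] at hs
      have hkh : 0 ≤ k * h := by positivity
      have hs' : s - h ≤ b + k * h := by
        push_cast at ht
        rcases le_max_iff.1 hs.2 with h' | h'
        · linarith
        · linarith [min_le_left t c]
      rw [history_congr fun u hu => ih u (hu.2.trans hs')]
  obtain ⟨k, hk⟩ := exists_nat_ge ((c - b) / h)
  rw [div_le_iff₀ hh] at hk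
  refine ⟨x (k + 1), (hx _).1, (hx _).2, fun t ht => ?_, fun t ht => ?_, fun t ht => ?_⟩
  · rw [hsucc, hpre k t ht]
  · rw [hsucc]
    simp [Φ, delayedPicard, hbc, ht, hbc.trans ht]
  · conv_lhs => rw [hsucc]
    simp only [Φ, delayedPicard, min_eq_right ht.1, min_eq_left ht.2, max_eq_right ht.1]
    congr 1
    refine intervalIntegral.integral_congr fun s hs => ?_
    rw [uIcc_of_le ht.1] at hs
    rw [history_congr fun u hu => (hstep k u (by linarith [hu.2, hs.2, ht.2])).symm]

/-- Peano's theorem for a right-hand side that is continuous for all times: the limit of the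
solutions of equations with an additional delay that tends to zero. -/
theorem exists_integral_eq_of_continuous [FiniteDimensional ℝ E]
    (hg : Continuous (Function.uncurry g))
    (hbdd : ∀ R : ℝ, ∃ M : ℝ, ∀ t ψ, ‖ψ‖ ≤ R → ‖g t ψ‖ ≤ M) {X₀ : ℝ → E}
    (hX₀ : Continuous X₀) {R₀ : ℝ} (hR₀ : ∀ t, ‖X₀ t‖ ≤ R₀) (b : ℝ) :
    ∃ c > b, ∃ X : ℝ → E, Continuous X ∧ (∀ t ≤ b, X t = X₀ t) ∧
      ∀ t ∈ Icc b c, X t = X₀ b + ∫ s in b..t, g s (history r X s) := by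
  obtain ⟨M, hM⟩ := hbdd (R₀ + 1)
  have hR0 : 0 ≤ R₀ + 1 := by linarith [norm_nonneg (X₀ 0), hR₀ 0]
  have hM0 : 0 ≤ M := (norm_nonneg _).trans (hM 0 0 (by simpa using hR0))
  have hc0 : 0 < 1 / (M + 1) := by positivity
  -- on `[b, c]`, functions whose derivative is bounded by `M` change by at most `1`
  set c := b + 1 / (M + 1) with hc
  have hbc : b < c := by linarith
  have hcM : M * (c - b) ≤ 1 := by
    rw [hc, add_sub_cancel_left, mul_one_div, div_le_one (by positivity)]
    linarith
  choose X hXc hXR hXpre hXpost hXeq using fun n : ℕ =>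
    exists_delayed_solution hg hX₀ hbc.le (R := R₀ + 1) (fun t => by simpa using hR₀ t) hM hcM
      (h := 1 / ((n : ℝ) + 1)) (by positivity)
  have hkc : ∀ n, Continuous fun s => g s (history r (X n) (s - 1 / ((n : ℝ) + 1))) :=
    fun n => continuous_comp_history hg (hXc n) _
  have hkM : ∀ n s, ‖g s (history r (X n) (s - 1 / ((n : ℝ) + 1)))‖ ≤ M :=
    fun n s => hM _ _ (norm_history_le (hXc n) hR0 (hXR n) _)
  obtain ⟨Y, σ, hσ, hY, hlim⟩ := exists_tendstoUniformly_subseq hbc.le hXc hXpre (M := M)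
    (fun n s hs t ht => by
      rw [hXeq n s hs, hXeq n t ht, add_sub_add_left_eq_sub,
        intervalIntegral.integral_interval_sub_left ((hkc n).intervalIntegrable _ _)
          ((hkc n).intervalIntegrable _ _)]
      exact intervalIntegral.norm_integral_le_of_norm_le_const fun s _ => hkM n s) hXpost
  refine ⟨c, hbc, Y, hY, fun t ht => ?_, fun t ht => ?_⟩
  · refine tendsto_nhds_unique (hlim.tendsto_at t) ?_
    simp [hXpre _ t ht]
  · refine tendsto_nhds_unique (hlim.tendsto_at t) ?_
    simp only [hXeq _ t ht]
    refine Tendsto.const_add _ ?_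
    refine intervalIntegral.tendsto_integral_filter_of_dominated_convergence (fun _ => M)
      (Eventually.of_forall fun n => (hkc _).aestronglyMeasurable)
      (Eventually.of_forall fun n => MeasureTheory.ae_of_all _ fun s _ => hkM _ s) (by simp)
      (MeasureTheory.ae_of_all _ fun s _ => ?_)
    have h0 : Tendsto (fun n => s - 1 / ((σ n : ℝ) + 1)) atTop (𝓝 s) := by
      simpa using (tendsto_one_div_add_atTop_nhds_zero_nat.comp hσ.tendsto_atTop).const_sub s
    exact (hg.tendsto (s, _)).comp (tendsto_const_nhds.prodMk_nhds
      (tendsto_history (fun n => hXc _) hY hlim h0))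

theorem exists_integral_eq_of_continuousOn [FiniteDimensional ℝ E]
    (hg : ContinuousOn (Function.uncurry g) (Ici 0 ×ˢ univ))
    (hbdd : ∀ R : ℝ, ∃ M : ℝ, ∀ t, 0 ≤ t → ∀ ψ, ‖ψ‖ ≤ R → ‖g t ψ‖ ≤ M) {X₀ : ℝ → E}
    (hX₀ : Continuous X₀) {R₀ : ℝ} (hR₀ : ∀ t, ‖X₀ t‖ ≤ R₀) {b : ℝ} (hb : 0 ≤ b) :
    ∃ c > b, ∃ X : ℝ → E, Continuous X ∧ (∀ t ≤ b, X t = X₀ t) ∧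
      ∀ t ∈ Icc b c, X t = X₀ b + ∫ s in b..t, g s (history r X s) := by
  obtain ⟨c, hbc, X, hX, hpre, heq⟩ :=
    exists_integral_eq_of_continuous (g := fun t => g (max t 0))
      (hg.comp_continuous (f := fun p : ℝ × C(Icc (-r) 0, E) => (max p.1 0, p.2)) (by fun_prop)
        fun p => ⟨mem_Ici.2 (le_max_right _ _), mem_univ _⟩)
      (fun R => (hbdd R).imp fun M hM t ψ => hM _ (le_max_right _ _) ψ) hX₀ hR₀ b
  refine ⟨c, hbc, X, hX, hpre, fun t ht => ?_⟩
  rw [heq t ht]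
  congr 1
  refine intervalIntegral.integral_congr fun s hs => ?_
  rw [uIcc_of_le ht.1] at hs
  simp [hb.trans hs.1]

end Existence

/-! ### Continuation of bounded solutions -/

section Continuation

/-- The function `x` on `[-r, T]`, extended to `ℝ` by its values at the end points. -/
def stopped {E : Type*} (r T : ℝ) (x : ℝ → E) (t : ℝ) : E := x (max (-r) (min t T))

variable {E : Type*} {r : ℝ}

theorem max_min_mem_Icc {T : ℝ} (hT : -r ≤ T) (t : ℝ) : max (-r) (min t T) ∈ Icc (-r) T :=
  ⟨le_max_left _ _, max_le hT (min_le_right _ _)⟩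

theorem stopped_eq {T t : ℝ} (x : ℝ → E) (ht : t ∈ Icc (-r) T) : stopped r T x t = x t := by
  rw [stopped, min_eq_left ht.2, max_eq_right ht.1]

variable [NormedAddCommGroup E]

theorem continuous_stopped {T : ℝ} (hT : -r ≤ T) {x : ℝ → E} (hx : ContinuousOn x (Icc (-r) T)) :
    Continuous (stopped r T x) :=
  hx.comp_continuous (by fun_prop : Continuous fun t : ℝ => max (-r) (min t T)) (max_min_mem_Icc hT)

variable [NormedSpace ℝ E] {g : ℝ → C(Icc (-r) 0, E) → E} {φ : C(Icc (-r) 0, E)}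

theorem IsSolution.Icc_subset_of_mem {I : Set ℝ} {x : ℝ → E} (hx : IsSolution r g φ I x)
    (hr : 0 ≤ r) {T : ℝ} (hT : T ∈ I) : Icc (-r) T ⊆ I :=
  hx.ordConnected.out (hx.Icc_subset ⟨le_rfl, by linarith⟩) hT

/-- The bound of the right-hand side on the ball that contains a solution is a Lipschitz constant
of the solution. -/
theorem IsSolution.norm_sub_le [CompleteSpace E] {I : Set ℝ} {x : ℝ → E}
    (hx : IsSolution r g φ I x) (hr : 0 ≤ r)
    (hg : ContinuousOn (Function.uncurry g) (Ici 0 ×ˢ univ)) {T R M : ℝ} (hT : T ∈ I)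
    (hR : ∀ t ∈ Icc (-r) T, ‖x t‖ ≤ R) (hM : ∀ t, 0 ≤ t → ∀ ψ, ‖ψ‖ ≤ R → ‖g t ψ‖ ≤ M)
    {s t : ℝ} (hs : s ∈ Icc 0 T) (ht : t ∈ Icc 0 T) : ‖x s - x t‖ ≤ M * |s - t| := by
  have hTI := hx.Icc_subset_of_mem hr hT
  have hrT : -r ≤ T := by linarith [hs.1, hs.2]
  have hR0 : 0 ≤ R := (norm_nonneg _).trans (hR T ⟨hrT, le_rfl⟩)
  have hX := continuous_stopped hrT (hx.continuousOn.mono hTI)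
  have heq := fun {u : ℝ} (hu : u ∈ Icc 0 T) =>
    hx.integral_eq hg hX hTI (fun v hv => (stopped_eq x hv).symm) hr hu
  have hk := continuousOn_comp_history hg (continuous_history (r := r) hX)
  rw [← stopped_eq (r := r) x ⟨by linarith [hs.1], hs.2⟩,
    ← stopped_eq (r := r) x ⟨by linarith [ht.1], ht.2⟩,
    heq hs, heq ht, add_sub_add_left_eq_sub, intervalIntegral.integral_interval_sub_left
      (intervalIntegrable_of_continuousOn_Ici hk le_rfl hs.1)
      (intervalIntegrable_of_continuousOn_Ici hk le_rfl ht.1)]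
  refine intervalIntegral.norm_integral_le_of_norm_le_const fun u hu => hM u ?_ _ ?_
  · exact (le_min ht.1 hs.1).trans hu.1.le
  · exact norm_history_le hX hR0 (fun v => hR _ (max_min_mem_Icc hrT v)) u

/-- Both sides of the integral equation are continuous, so that it extends to the right end
point. -/
theorem integral_eq_Icc_of_Ico (hg : ContinuousOn (Function.uncurry g) (Ici 0 ×ˢ univ))
    {X : ℝ → E} (hX : Continuous X) {b : ℝ} (hb : 0 < b)
    (h : ∀ t ∈ Ico 0 b, X t = X 0 + ∫ s in (0 : ℝ)..t, g s (history r X s)) :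
    ∀ t ∈ Icc 0 b, X t = X 0 + ∫ s in (0 : ℝ)..t, g s (history r X s) := by
  have hk := continuousOn_comp_history hg (continuous_history (r := r) hX)
  have hc : Continuous fun s : ℝ => g (max s 0) (history r X (max s 0)) :=
    hk.comp_continuous (by fun_prop : Continuous fun s : ℝ => max s 0)
      fun s => mem_Ici.2 (le_max_right _ _)
  have hI : ∀ t, 0 ≤ t → ∫ s in (0 : ℝ)..t, g (max s 0) (history r X (max s 0)) =
      ∫ s in (0 : ℝ)..t, g s (history r X s) := fun t ht =>
    intervalIntegral.integral_congr fun s hs => by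
      rw [uIcc_of_le ht] at hs
      simp [hs.1]
  have hclos : EqOn X
      (fun t => X 0 + ∫ s in (0 : ℝ)..t, g (max s 0) (history r X (max s 0)))
      (closure (Ico 0 b)) := by
    refine EqOn.closure (fun t ht => ?_) hX (continuous_const.add
      (intervalIntegral.continuous_primitive (fun _ _ => hc.intervalIntegrable _ _) 0))
    simp only [hI t ht.1]
    exact h t ht
  rw [closure_Ico hb.ne] at hclos
  intro t ht
  rw [← hI t ht.1]
  exact hclos ht

/-- Peano's theorem and the Cauchy criterion continue a solution that stays bounded up to `L`
beyond every right end point of its interval before `L`. -/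
theorem IsMaximalSolution.Icc_subset_of_bounded [FiniteDimensional ℝ E] {I : Set ℝ} {x : ℝ → E}
    (hmax : IsMaximalSolution r g φ I x) (hr : 0 ≤ r)
    (hg : ContinuousOn (Function.uncurry g) (Ici 0 ×ˢ univ))
    (hbdd : ∀ R : ℝ, ∃ M : ℝ, ∀ t, 0 ≤ t → ∀ ψ, ‖ψ‖ ≤ R → ‖g t ψ‖ ≤ M) {L R : ℝ}
    (hR : ∀ t ∈ I, t ≤ L → ‖x t‖ ≤ R) : Icc (-r) L ⊆ I := by
  have hcs : CompleteSpace E := FiniteDimensional.complete ℝ E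
  obtain ⟨hx, hmax⟩ := hmax
  by_contra hnot
  obtain ⟨p, hp, hpI⟩ := not_subset.1 hnot
  have hlt : ∀ t ∈ I, t < p := fun t ht => by
    by_contra! h
    exact hpI (hx.Icc_subset_of_mem hr ht ⟨hp.1, h⟩)
  obtain ⟨t₀, ht₀, ht₀'⟩ := hx.exists_pos
  set b := sSup I with hbdef
  have hlub : IsLUB I b := isLUB_csSup ⟨t₀, ht₀⟩ ⟨p, fun t ht => (hlt t ht).le⟩
  have hb : 0 < b := ht₀'.trans_le (hlub.1 ht₀)
  have hbL : b ≤ L := (hlub.2 fun t ht => (hlt t ht).le).trans hp.2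
  have hrb : -r ≤ b := by linarith
  have hsub : I ⊆ Icc (-r) b := fun t ht => ⟨hx.subset_Ici ht, hlub.1 ht⟩
  have hRI : ∀ t ∈ I, ‖x t‖ ≤ R := fun t ht => hR t ht ((hsub ht).2.trans hbL)
  have hIco : ∀ t, -r ≤ t → t < b → t ∈ I := fun t h1 h2 => by
    obtain ⟨u, hu, htu, -⟩ := hlub.exists_between h2
    exact hx.Icc_subset_of_mem hr hu ⟨h1, htu.le⟩
  by_cases hbI : b ∈ I
  · -- the right end point belongs to `I`: restart the equation there
    have hbsub := hx.Icc_subset_of_mem hr hbI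
    obtain ⟨c, hbc, X, hX, hpre, heq⟩ := exists_integral_eq_of_continuousOn hg hbdd
      (continuous_stopped hrb (hx.continuousOn.mono hbsub))
      (fun t => hRI _ (hbsub (max_min_mem_Icc hrb t))) hb.le
    have hxX : EqOn x X (Icc (-r) b) := fun t ht => by rw [hpre t ht.2, stopped_eq x ht]
    have hk := continuousOn_comp_history hg (continuous_history (r := r) hX)
    have hint : ∀ t ∈ Icc 0 b, X t = X 0 + ∫ s in (0 : ℝ)..t, g s (history r X s) :=
      fun t ht => hx.integral_eq hg hX hbsub hxX hr ht
    have hsol : IsSolution r g φ (Icc (-r) c) X := by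
      refine isSolution_of_integral_eq hr hg hX (hb.trans hbc) (fun θ => ?_) fun t ht => ?_
      · rw [← hxX ⟨θ.2.1, θ.2.2.trans hb.le⟩, hx.initial]
      · rcases le_total t b with h | h
        · exact hint t ⟨ht.1, h⟩
        · rw [heq t ⟨h, ht.2⟩, ← hpre b le_rfl, hint b ⟨hb.le, le_rfl⟩, add_assoc,
            intervalIntegral.integral_add_adjacent_intervals
              (intervalIntegrable_of_continuousOn_Ici hk le_rfl hb.le)
              (intervalIntegrable_of_continuousOn_Ici hk hb.le ht.1)]
    have hIc := hmax _ X hsol (hsub.trans (Icc_subset_Icc_right hbc.le))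
      fun t ht => (hxX (hsub ht)).symm
    have hcI : c ∈ I := hIc ▸ ⟨by linarith, le_rfl⟩
    exact absurd (hlub.1 hcI) (not_le.2 hbc)
  · -- the right end point does not belong to `I`: the solution is Lipschitz, and has a limit there
    obtain ⟨M, hM⟩ := hbdd R
    have hlip : LipschitzOnWith (Real.toNNReal M) x (Ico 0 b) := by
      refine LipschitzOnWith.of_dist_le_mul fun s hs t ht => ?_
      have hmb : max s t < b := max_lt hs.2 ht.2
      have hmr : -r ≤ max s t := by linarith [hs.1, le_max_left s t]
      rw [dist_eq_norm]
      refine (hx.norm_sub_le hr hg (hIco _ hmr hmb)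
        (fun u hu => hRI u (hIco u hu.1 (hu.2.trans_lt hmb))) hM ⟨hs.1, le_max_left _ _⟩
        ⟨ht.1, le_max_right _ _⟩).trans ?_
      rw [Real.dist_eq]
      gcongr
      exact Real.le_coe_toNNReal M
    obtain ⟨z, hz, hzx⟩ := hlip.extend_finite_dimension
    have h0 := hz.continuous
    set X : ℝ → E := fun t => stopped r 0 x t + (z (max t 0) - z 0) with hXdef
    have hX : Continuous X :=
      (continuous_stopped (by linarith) (hx.continuousOn.mono hx.Icc_subset)).add (by fun_prop)
    have hxX : ∀ t, -r ≤ t → t < b → x t = X t := by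
      intro t h1 h2
      rcases le_total t 0 with h | h
      · simp [hXdef, stopped_eq x ⟨h1, h⟩, h]
      · have e : stopped r 0 x t = x 0 := by simp [stopped, h, hr]
        simp only [hXdef, e, max_eq_left h]
        rw [← hzx ⟨h, h2⟩, ← hzx ⟨le_rfl, hb⟩]
        abel
    have hsol : IsSolution r g φ (Icc (-r) b) X := by
      refine isSolution_of_integral_eq hr hg hX hb (fun θ => ?_)
        (integral_eq_Icc_of_Ico hg hX hb fun t ht => ?_)
      · rw [← hxX θ θ.2.1 (θ.2.2.trans_lt hb), hx.initial]
      · exact hx.integral_eq hg hX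
          (hx.Icc_subset_of_mem hr (hIco t (by linarith [ht.1]) ht.2))
          (fun u hu => hxX u hu.1 (hu.2.trans_lt ht.2)) hr ⟨ht.1, le_rfl⟩
    have hIb := hmax _ X hsol hsub fun t ht =>
      (hxX t (hsub ht).1 ((hsub ht).2.lt_of_ne fun h => hbI (h ▸ ht))).symm
    exact hbI (hIb ▸ ⟨hrb, le_rfl⟩)

end Continuation

/-! ### Averaging along a curve -/

section Averaging

variable {E : Type*} [NormedAddCommGroup E] {V : Type*} [NormedAddCommGroup V]
  {f : ℝ → V → E}

/-- Continuity that is uniform with respect to time is uniform along a compact curve. -/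
theorem exists_uniform_modulus
    (h1 : ∀ ψ : V, ∀ η > 0, ∃ ρ > 0, ∀ ψ' : V, ‖ψ' - ψ‖ < ρ → ∀ t : ℝ, 0 ≤ t →
      ‖f t ψ' - f t ψ‖ < η) {H : ℝ → V} (hH : Continuous H) (L : ℝ) {η : ℝ} (hη : 0 < η) :
    ∃ d > 0, ∀ s ∈ Icc 0 L, ∀ u ∈ Icc 0 L, |s - u| < d → ∀ t, 0 ≤ t →
      ‖f t (H s) - f t (H u)‖ ≤ η := by
  let G : ℝ → UniformFun (Ici (0 : ℝ)) E := fun s => UniformFun.ofFun fun t => f t (H s)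
  have hG : Continuous G := by
    refine continuous_iff_continuousAt.2 fun s => ?_
    rw [ContinuousAt, UniformFun.tendsto_iff_tendstoUniformly, Metric.tendstoUniformly_iff]
    intro ζ hζ
    obtain ⟨ρ, hρ, h⟩ := h1 (H s) ζ hζ
    filter_upwards [hH.continuousAt.eventually (Metric.ball_mem_nhds (H s) hρ)] with u hu t
    rw [dist_comm, dist_eq_norm]
    exact h (H u) (by rwa [← dist_eq_norm]) t t.2
  have hunif := isCompact_Icc.uniformContinuousOn_of_continuous (hG.continuousOn (s := Icc 0 L))
  have hmem := (UniformFun.hasBasis_uniformity (Ici (0 : ℝ)) E).mem_of_mem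
    (Metric.dist_mem_uniformity hη)
  have hmem' := hunif hmem
  rw [mem_map, mem_inf_principal, Metric.mem_uniformity_dist] at hmem'
  obtain ⟨d, hd, h⟩ := hmem'
  refine ⟨d, hd, fun s hs u hu hsu t ht => ?_⟩
  have : dist (f t (H s)) (f t (H u)) < η :=
    h (a := s) (b := u) (by rwa [Real.dist_eq]) ⟨hs, hu⟩ ⟨t, ht⟩
  rw [dist_eq_norm] at this
  exact this.le

variable (hf : ContinuousOn (Function.uncurry f) (Ici 0 ×ˢ univ))

include hf in
theorem continuousOn_rescaled {ε : ℝ} (hε : 0 < ε) :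
    ContinuousOn (Function.uncurry fun t => f (t / ε)) (Ici 0 ×ˢ univ) :=
  hf.comp (f := fun p : ℝ × V => (p.1 / ε, p.2)) (by fun_prop)
    fun _ hp => ⟨div_nonneg hp.1 hε.le, mem_univ _⟩

include hf in
theorem continuousOn_rescaled_comp {ε : ℝ} (hε : 0 < ε) {H : ℝ → V} (hH : Continuous H) :
    ContinuousOn (fun s => f (s / ε) (H s)) (Ici 0) :=
  (continuousOn_rescaled hf hε).comp (f := fun s : ℝ => (s, H s)) (by fun_prop)
    fun _ hs => ⟨hs, mem_univ _⟩

variable [NormedSpace ℝ E] {F : V → E}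
  (h3 : ∀ ψ : V, Tendsto (fun T : ℝ => (1 / T) • ∫ t in (0 : ℝ)..T, f t ψ) atTop (𝓝 (F ψ)))

include hf h3 in
theorem norm_average_sub_le {ψ ψ' : V} {η : ℝ} (h : ∀ t, 0 ≤ t → ‖f t ψ' - f t ψ‖ ≤ η) :
    ‖F ψ' - F ψ‖ ≤ η := by
  refine le_of_tendsto ((h3 ψ').sub (h3 ψ)).norm ?_
  filter_upwards [eventually_gt_atTop 0] with T hT
  have hi : ∀ ψ, IntervalIntegrable (fun t => f t ψ) MeasureTheory.volume 0 T := fun ψ => by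
    simpa using intervalIntegrable_of_continuousOn_Ici
      (continuousOn_rescaled_comp hf one_pos (continuous_const (y := ψ))) le_rfl hT.le
  rw [← smul_sub, ← intervalIntegral.integral_sub (hi _) (hi _), norm_smul]
  have := intervalIntegral.norm_integral_le_of_norm_le_const (a := 0) (b := T)
    (f := fun t => f t ψ' - f t ψ) (C := η) fun t ht => h t <| by
      rw [uIoc_of_le hT.le] at ht
      exact ht.1.le
  rw [sub_zero, abs_of_pos hT] at this
  calc ‖1 / T‖ * _ ≤ ‖1 / T‖ * (η * T) := by gcongr
    _ = η := by
      rw [Real.norm_of_nonneg (by positivity)]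
      field_simp

include hf h3 in
theorem continuous_average
    (h1 : ∀ ψ : V, ∀ η > 0, ∃ ρ > 0, ∀ ψ' : V, ‖ψ' - ψ‖ < ρ → ∀ t : ℝ, 0 ≤ t →
      ‖f t ψ' - f t ψ‖ < η) : Continuous F := by
  rw [Metric.continuous_iff]
  intro ψ η hη
  obtain ⟨ρ, hρ, h⟩ := h1 ψ (η / 2) (by positivity)
  refine ⟨ρ, hρ, fun ψ' hψ' => ?_⟩
  rw [dist_eq_norm] at hψ' ⊢
  linarith [norm_average_sub_le hf h3 fun t ht => (h ψ' hψ' t ht).le]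

include hf h3 in
theorem tendsto_integral_rescaled_const {ε : ℕ → ℝ} (hε : ∀ n, 0 < ε n)
    (hε0 : Tendsto ε atTop (𝓝 0)) (ψ : V) {a b : ℝ} (ha : 0 ≤ a) (hb : 0 ≤ b) :
    Tendsto (fun n => ∫ s in a..b, f (s / ε n) ψ) atTop (𝓝 ((b - a) • F ψ)) := by
  have key : ∀ c : ℝ, 0 ≤ c →
      Tendsto (fun n => ∫ s in (0 : ℝ)..c, f (s / ε n) ψ) atTop (𝓝 (c • F ψ)) := by
    intro c hc
    rcases hc.eq_or_lt with rfl | hc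
    · simp
    have hT : Tendsto (fun n => c / ε n) atTop atTop := by
      refine Tendsto.const_mul_atTop hc (tendsto_inv_nhdsGT_zero.comp ?_)
      exact tendsto_nhdsWithin_iff.2 ⟨hε0, Eventually.of_forall hε⟩
    refine (((h3 ψ).comp hT).const_smul c).congr fun n => ?_
    have hn := (hε n).ne'
    rw [intervalIntegral.integral_comp_div (fun s => f s ψ) hn, zero_div, Function.comp,
      smul_smul]
    congr 1
    field_simp
  have hi : ∀ n c, 0 ≤ c →
      IntervalIntegrable (fun s => f (s / ε n) ψ) MeasureTheory.volume 0 c := fun n c hc =>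
    intervalIntegrable_of_continuousOn_Ici
      (continuousOn_rescaled_comp hf (hε n) (continuous_const (y := ψ))) le_rfl hc
  rw [sub_smul]
  refine ((key b hb).sub (key a ha)).congr fun n => ?_
  exact intervalIntegral.integral_interval_sub_left (hi n b hb) (hi n a ha)

include hf h3 in
/-- Averaging along a fixed curve. On short time intervals the curve is almost constant, and the
error of this approximation is proportional to the length of the interval; the errors of the
averages at the finitely many constant values tend to zero. -/
theorem tendsto_integral_rescaled [CompleteSpace E]
    (h1 : ∀ ψ : V, ∀ η > 0, ∃ ρ > 0, ∀ ψ' : V, ‖ψ' - ψ‖ < ρ → ∀ t : ℝ, 0 ≤ t →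
      ‖f t ψ' - f t ψ‖ < η) {ε : ℕ → ℝ} (hε : ∀ n, 0 < ε n) (hε0 : Tendsto ε atTop (𝓝 0))
    {H : ℝ → V} (hH : Continuous H) {L : ℝ} (hL : 0 ≤ L) :
    Tendsto (fun n => ∫ s in (0 : ℝ)..L, f (s / ε n) (H s)) atTop
      (𝓝 (∫ s in (0 : ℝ)..L, F (H s))) := by
  have hFc : Continuous fun s => F (H s) := (continuous_average hf h3 h1).comp hH
  have hki := fun (n : ℕ) {a b : ℝ} (ha : 0 ≤ a) (hb : 0 ≤ b) =>
    intervalIntegrable_of_continuousOn_Ici (continuousOn_rescaled_comp hf (hε n) hH) ha hb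
  have hki' := fun (n : ℕ) (ψ : V) {a b : ℝ} (ha : 0 ≤ a) (hb : 0 ≤ b) =>
    intervalIntegrable_of_continuousOn_Ici
      (continuousOn_rescaled_comp hf (hε n) (continuous_const (y := ψ))) ha hb
  have hFi : ∀ a b, IntervalIntegrable (fun s => F (H s)) MeasureTheory.volume a b :=
    fun a b => hFc.intervalIntegrable a b
  have main : ∀ η > 0, ∀ ζ > 0, ∀ᶠ n in atTop,
      ‖(∫ s in (0 : ℝ)..L, f (s / ε n) (H s)) - ∫ s in (0 : ℝ)..L, F (H s)‖
        ≤ 2 * η * L + ζ := by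
    intro η hη
    obtain ⟨d, hd, hmod⟩ := exists_uniform_modulus h1 hH L hη
    have step : ∀ k : ℕ, ∀ u ∈ Icc 0 L, u ≤ k * (d / 2) → ∀ ζ > 0, ∀ᶠ n in atTop,
        ‖(∫ s in (0 : ℝ)..u, f (s / ε n) (H s)) - ∫ s in (0 : ℝ)..u, F (H s)‖
          ≤ 2 * η * u + ζ := by
      intro k
      induction k with
      | zero =>
        intro u hu huk ζ hζ
        obtain rfl : u = 0 := le_antisymm (by simpa using huk) hu.1
        simp [hζ.le]
      | succ k ih =>
        intro u hu huk ζ hζ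
        set v := max 0 (u - d / 2) with hv
        have hv0 : 0 ≤ v := le_max_left _ _
        have hvu : v ≤ u := max_le hu.1 (by linarith)
        have huv : u - d / 2 ≤ v := le_max_right _ _
        have hvk : v ≤ k * (d / 2) := by
          push_cast at huk
          exact max_le (by positivity) (by linarith)
        have hlast := tendsto_integral_rescaled_const hf h3 hε hε0 (H u) hv0 hu.1
        rw [tendsto_iff_norm_sub_tendsto_zero] at hlast
        filter_upwards [ih v ⟨hv0, hvu.trans hu.2⟩ hvk (ζ / 2) (by positivity),
          hlast.eventually (gt_mem_nhds (half_pos hζ))] with n hn₁ hn₂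
        have hsu : ∀ s ∈ uIoc v u, s ∈ Icc 0 L ∧ |s - u| < d := by
          intro s hs
          rw [uIoc_of_le hvu] at hs
          refine ⟨⟨hv0.trans hs.1.le, hs.2.trans hu.2⟩, abs_lt.2 ⟨?_, ?_⟩⟩ <;>
            linarith [hs.1, hs.2]
        have e₁ : ‖∫ s in v..u, (f (s / ε n) (H s) - f (s / ε n) (H u))‖ ≤ η * (u - v) := by
          refine (intervalIntegral.norm_integral_le_of_norm_le_const fun s hs => ?_).trans_eq
            (by rw [abs_of_nonneg (sub_nonneg.2 hvu)])
          exact hmod s (hsu s hs).1 u hu (hsu s hs).2 _ (div_nonneg (hsu s hs).1.1 (hε n).le)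
        have e₂ : ‖∫ s in v..u, (F (H s) - F (H u))‖ ≤ η * (u - v) := by
          refine (intervalIntegral.norm_integral_le_of_norm_le_const fun s hs => ?_).trans_eq
            (by rw [abs_of_nonneg (sub_nonneg.2 hvu)])
          exact norm_average_sub_le hf h3 (hmod s (hsu s hs).1 u hu (hsu s hs).2)
        rw [intervalIntegral.integral_sub (hki n hv0 hu.1) (hki' n _ hv0 hu.1)] at e₁
        rw [intervalIntegral.integral_sub (hFi _ _) (by simp),
          intervalIntegral.integral_const] at e₂
        rw [← intervalIntegral.integral_add_adjacent_intervals (hki n le_rfl hv0)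
            (hki n hv0 hu.1),
          ← intervalIntegral.integral_add_adjacent_intervals (hFi 0 v) (hFi v u)]
        set A := ∫ s in (0 : ℝ)..v, f (s / ε n) (H s)
        set B := ∫ s in (0 : ℝ)..v, F (H s)
        set A' := ∫ s in v..u, f (s / ε n) (H s)
        set B' := ∫ s in v..u, F (H s)
        set P := ∫ s in v..u, f (s / ε n) (H u)
        set Q := (u - v) • F (H u)
        have hsplit : A + A' - (B + B') = (A - B) + ((A' - P) - (B' - Q) + (P - Q)) := by abel
        rw [hsplit]
        have := norm_add_le (A - B) ((A' - P) - (B' - Q) + (P - Q))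
        have := norm_add_le ((A' - P) - (B' - Q)) (P - Q)
        have := norm_sub_le (A' - P) (B' - Q)
        linarith
    obtain ⟨k, hk⟩ := exists_nat_ge (L / (d / 2))
    rw [div_le_iff₀ (by positivity)] at hk
    exact step k L ⟨hL, le_rfl⟩ hk
  rw [tendsto_iff_norm_sub_tendsto_zero, Metric.tendsto_nhds]
  intro ω hω
  have hη : 0 < ω / (4 * (L + 1)) := by positivity
  filter_upwards [main _ hη (ω / 4) (by positivity)] with n hn
  rw [dist_zero_right, norm_norm]
  have : 2 * (ω / (4 * (L + 1))) * L ≤ ω / 2 := by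
    have : 2 * (ω / (4 * (L + 1))) * L = ω / 2 * (L / (L + 1)) := by field_simp; ring
    rw [this]
    exact mul_le_of_le_one_right (by positivity) ((div_le_one (by positivity)).2 (by linarith))
  linarith

include hf h3 in
/-- Averaging along a convergent sequence of curves. -/
theorem tendsto_integral_rescaled_of_tendsto [CompleteSpace E]
    (h1 : ∀ ψ : V, ∀ η > 0, ∃ ρ > 0, ∀ ψ' : V, ‖ψ' - ψ‖ < ρ → ∀ t : ℝ, 0 ≤ t →
      ‖f t ψ' - f t ψ‖ < η) {ε : ℕ → ℝ} (hε : ∀ n, 0 < ε n) (hε0 : Tendsto ε atTop (𝓝 0))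
    {H : ℕ → ℝ → V} {H₀ : ℝ → V} (hH : ∀ n, Continuous (H n)) (hH₀ : Continuous H₀)
    (hlim : ∀ s, Tendsto (fun n => H n s) atTop (𝓝 (H₀ s))) {M : ℝ}
    (hM : ∀ n s t, 0 ≤ t → ‖f t (H n s)‖ ≤ M) {L : ℝ} (hL : 0 ≤ L) :
    Tendsto (fun n => ∫ s in (0 : ℝ)..L, f (s / ε n) (H n s)) atTop
      (𝓝 (∫ s in (0 : ℝ)..L, F (H₀ s))) := by
  have hlim' : ∀ s, ∀ η > 0, ∀ᶠ n in atTop, ∀ t, 0 ≤ t → ‖f t (H n s) - f t (H₀ s)‖ < η := by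
    intro s η hη
    obtain ⟨ρ, hρ, h⟩ := h1 (H₀ s) η hη
    filter_upwards [(hlim s).eventually (Metric.ball_mem_nhds _ hρ)] with n hn
    exact h _ (by rwa [← dist_eq_norm])
  have hM₀ : ∀ s t, 0 ≤ t → ‖f t (H₀ s)‖ ≤ M := by
    intro s t ht
    refine le_of_tendsto (x := atTop) (f := fun n => ‖f t (H n s)‖) (Tendsto.norm ?_)
      (Eventually.of_forall fun n => hM n s t ht)
    rw [tendsto_iff_norm_sub_tendsto_zero, Metric.tendsto_nhds]
    intro η hη
    filter_upwards [hlim' s η hη] with n hn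
    simpa using hn t ht
  have hki : ∀ n, IntervalIntegrable (fun s => f (s / ε n) (H n s)) MeasureTheory.volume 0 L :=
    fun n => intervalIntegrable_of_continuousOn_Ici
      (continuousOn_rescaled_comp hf (hε n) (hH n)) le_rfl hL
  have hki₀ : ∀ n, IntervalIntegrable (fun s => f (s / ε n) (H₀ s)) MeasureTheory.volume 0 L :=
    fun n => intervalIntegrable_of_continuousOn_Ici
      (continuousOn_rescaled_comp hf (hε n) hH₀) le_rfl hL
  have hdiff : Tendsto
      (fun n => ∫ s in (0 : ℝ)..L, (f (s / ε n) (H n s) - f (s / ε n) (H₀ s))) atTop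
      (𝓝 (∫ _ in (0 : ℝ)..L, (0 : E))) := by
    have hpos : ∀ s ∈ uIoc 0 L, 0 ≤ s := fun s hs => by
      rw [uIoc_of_le hL] at hs
      exact hs.1.le
    refine intervalIntegral.tendsto_integral_filter_of_dominated_convergence (fun _ => M + M)
      (Eventually.of_forall fun n => ((hki n).sub (hki₀ n)).aestronglyMeasurable_restrict_uIoc)
      (Eventually.of_forall fun n => MeasureTheory.ae_of_all _ fun s hs => ?_) (by simp)
      (MeasureTheory.ae_of_all _ fun s hs => ?_)
    · have hs' := div_nonneg (hpos s hs) (hε n).le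
      exact (norm_sub_le _ _).trans (add_le_add (hM n s _ hs') (hM₀ s _ hs'))
    · rw [Metric.tendsto_nhds]
      intro η hη
      filter_upwards [hlim' s η hη] with n hn
      simpa using hn _ (div_nonneg (hpos s hs) (hε n).le)
  have := hdiff.add (tendsto_integral_rescaled hf h3 h1 hε hε0 hH₀ hL)
  rw [intervalIntegral.integral_zero, zero_add] at this
  refine this.congr fun n => ?_
  rw [intervalIntegral.integral_sub (hki n) (hki₀ n)]
  abel

end Averaging

/-! ### Comparison with the averaged equation -/

section Comparison

variable {E : Type*} [NormedAddCommGroup E]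

/-- A path that starts inside the ball of radius `δ` and ends outside has a first time of distance
`δ` from the centre. -/
theorem exists_first_exit {u : ℝ → E} {T δ : ℝ} (hT : 0 ≤ T) (hu : ContinuousOn u (Icc 0 T))
    (h0 : ‖u 0‖ < δ) (hδ : δ ≤ ‖u T‖) :
    ∃ τ ∈ Ioc 0 T, (∀ t ∈ Icc 0 τ, ‖u t‖ ≤ δ) ∧ ‖u τ‖ = δ := by
  have hcl : IsCompact (Icc 0 T ∩ (fun t => ‖u t‖) ⁻¹' Ici δ) :=
    isCompact_Icc.of_isClosed_subset
      (hu.norm.preimage_isClosed_of_isClosed isClosed_Icc isClosed_Ici) inter_subset_left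
  obtain ⟨τ, ⟨hτ, hτδ⟩, hleast⟩ := hcl.exists_isLeast ⟨T, ⟨hT, le_rfl⟩, hδ⟩
  obtain ⟨s, hs, hsδ⟩ := intermediate_value_Icc hτ.1
    (hu.norm.mono (Icc_subset_Icc_right hτ.2)) ⟨h0.le, hτδ⟩
  have hsτ : s = τ := le_antisymm hs.2 (hleast ⟨⟨hs.1, hs.2.trans hτ.2⟩, hsδ.ge⟩)
  have hτeq : ‖u τ‖ = δ := hsτ ▸ hsδ
  refine ⟨τ, ⟨hτ.1.lt_of_ne fun h => ?_, hτ.2⟩, fun t ht => ?_, hτeq⟩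
  · rw [← h] at hτeq
    exact h0.ne hτeq
  · rcases ht.2.eq_or_lt with rfl | h
    · exact hτeq.le
    · by_contra! hc
      exact absurd (hleast ⟨⟨ht.1, ht.2.trans hτ.2⟩, hc.le⟩) (not_le.2 h)

end Comparison
end RFDE

theorem theorem2p8 {E : Type*} [NormedAddCommGroup E] [NormedSpace ℝ E] [FiniteDimensional ℝ E]
    (r : ℝ) (hr : 0 ≤ r)
    (f : ℝ → C(Icc (-r) 0, E) → E) (φ : C(Icc (-r) 0, E))
    (hf : ContinuousOn (Function.uncurry f) (Ici 0 ×ˢ univ))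
    -- continuity in the second variable, uniformly with respect to the first
    (h1 : ∀ ψ : C(Icc (-r) 0, E), ∀ η > 0, ∃ ρ > 0, ∀ ψ' : C(Icc (-r) 0, E),
      ‖ψ' - ψ‖ < ρ → ∀ t : ℝ, 0 ≤ t → ‖f t ψ' - f t ψ‖ < η)
    -- uniform quasi-boundedness
    (h2 : ∀ B : Set C(Icc (-r) 0, E), Bornology.IsBounded B →
      ∃ M : ℝ, ∀ t : ℝ, 0 ≤ t → ∀ ψ ∈ B, ‖f t ψ‖ ≤ M)
    -- the average
    (F : C(Icc (-r) 0, E) → E)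
    (h3 : ∀ ψ : C(Icc (-r) 0, E),
      Tendsto (fun T : ℝ => (1 / T) • ∫ t in (0 : ℝ)..T, f t ψ) atTop (𝓝 (F ψ)))
    -- unique solvability of the averaged problem, and its solution
    (h6 : RFDE.HasUniqueSolution r (fun _ ψ => F ψ) φ)
    (J : Set ℝ) (y : ℝ → E) (hy : RFDE.IsMaximalSolution r (fun _ ψ => F ψ) φ J y)
    (L : ℝ) (hL : 0 < L) (hLJ : L ∈ J) :
    ∀ δ > 0, ∃ ε₀ > 0, ∀ ε : ℝ, 0 < ε → ε ≤ ε₀ →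
      ∀ (I : Set ℝ) (x : ℝ → E),
        RFDE.IsMaximalSolution r (fun t ψ => f (t / ε) ψ) φ I x →
          Icc (-r) L ⊆ I ∧ ∀ t ∈ Icc 0 L, ‖x t - y t‖ < δ := by
  have hcs : CompleteSpace E := FiniteDimensional.complete ℝ E
  intro δ hδ
  by_contra! hcon
  choose ε hε hεle I x hx hbad using fun n : ℕ =>
    hcon (1 / ((n : ℝ) + 1)) (by positivity)
  have hε0 : Tendsto ε atTop (𝓝 0) :=
    squeeze_zero (fun n => (hε n).le) hεle tendsto_one_div_add_atTop_nhds_zero_nat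
  have hrL : -r ≤ L := by linarith
  have hyJ := hy.1.Icc_subset_of_mem hr hLJ
  have hyc := hy.1.continuousOn.mono hyJ
  obtain ⟨R₁, hR₁⟩ := isCompact_Icc.exists_bound_of_continuousOn hyc
  have hR₁0 : 0 ≤ R₁ := (norm_nonneg _).trans (hR₁ L ⟨hrL, le_rfl⟩)
  have hfbdd : ∀ R : ℝ, ∃ M : ℝ, ∀ t, 0 ≤ t → ∀ ψ : C(Icc (-r) 0, E), ‖ψ‖ ≤ R → ‖f t ψ‖ ≤ M :=
    fun R => (h2 _ (Metric.isBounded_closedBall (x := 0) (r := R))).imp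
      fun M hM t ht ψ hψ => hM t ht ψ (by simpa using hψ)
  have hgc := fun n => RFDE.continuousOn_rescaled hf (hε n)
  have hxy0 : ∀ n, ∀ t ∈ Icc (-r) 0, x n t = y t := fun n t ht =>
    ((hx n).1.initial ⟨t, ht⟩).trans (hy.1.initial ⟨t, ht⟩).symm
  -- a solution that violates the conclusion leaves the `δ`-neighbourhood of `y` within `[0, L]`,
  -- since otherwise it is bounded and continues up to `L`
  have hexit : ∀ n, ∃ t ∈ I n, t ∈ Icc 0 L ∧ δ ≤ ‖x n t - y t‖ := by
    intro n
    by_contra! h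
    have hsub : Icc (-r) L ⊆ I n := by
      refine (hx n).Icc_subset_of_bounded hr (hgc n) (fun R => ?_) (R := R₁ + δ) fun t ht htL => ?_
      · exact (hfbdd R).imp fun M hM t ht => hM _ (div_nonneg ht (hε n).le)
      · have hyt := hR₁ t ⟨(hx n).1.subset_Ici ht, htL⟩
        rcases le_total t 0 with h0 | h0
        · rw [hxy0 n t ⟨(hx n).1.subset_Ici ht, h0⟩]
          linarith
        · have := norm_add_le (x n t - y t) (y t)
          rw [sub_add_cancel] at this
          linarith [h t ht ⟨h0, htL⟩]
    obtain ⟨t, ht, htδ⟩ := hbad n hsub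
    exact absurd (h t (hsub ⟨by linarith [ht.1], ht.2⟩) ht) (not_lt.2 htδ)
  have hfirst : ∀ n, ∃ τ ∈ I n, τ ∈ Ioc 0 L ∧ (∀ t ∈ Icc 0 τ, ‖x n t - y t‖ ≤ δ) ∧
      ‖x n τ - y τ‖ = δ := by
    intro n
    obtain ⟨T, hTI, hT, hTδ⟩ := hexit n
    have hsub := (hx n).1.Icc_subset_of_mem hr hTI
    have h0T : Icc 0 T ⊆ Icc (-r) T := Icc_subset_Icc_left (by linarith)
    obtain ⟨τ, hτ, h, h'⟩ := RFDE.exists_first_exit (u := fun t => x n t - y t) (δ := δ) hT.1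
      (((hx n).1.continuousOn.mono (h0T.trans hsub)).sub
        (hyc.mono (h0T.trans (Icc_subset_Icc_right hT.2))))
      (by simpa [hxy0 n 0 ⟨by linarith, le_rfl⟩] using hδ) hTδ
    exact ⟨τ, hsub ⟨by linarith [hτ.1], hτ.2⟩, ⟨hτ.1, hτ.2.trans hT.2⟩, h, h'⟩
  choose τ hτI hτ hτle hτeq using hfirst
  have hrτ : ∀ n, -r ≤ τ n := fun n => by linarith [(hτ n).1]
  have hτsub := fun n => (hx n).1.Icc_subset_of_mem hr (hτI n)
  have hxR : ∀ n, ∀ t ∈ Icc (-r) (τ n), ‖x n t‖ ≤ R₁ + δ := by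
    intro n t ht
    have hyt := hR₁ t ⟨ht.1, ht.2.trans (hτ n).2⟩
    rcases le_total t 0 with h0 | h0
    · rw [hxy0 n t ⟨ht.1, h0⟩]
      linarith
    · have := norm_add_le (x n t - y t) (y t)
      rw [sub_add_cancel] at this
      linarith [hτle n t ⟨h0, ht.2⟩]
  obtain ⟨M, hM⟩ := hfbdd (R₁ + δ)
  have hM0 : 0 ≤ M := (norm_nonneg _).trans (hM 0 le_rfl 0 (by simpa using by positivity))
  set X : ℕ → ℝ → E := fun n => RFDE.stopped r (τ n) (x n) with hXdef
  have hXc : ∀ n, Continuous (X n) := fun n =>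
    RFDE.continuous_stopped (hrτ n) ((hx n).1.continuousOn.mono (hτsub n))
  have hXR : ∀ n t, ‖X n t‖ ≤ R₁ + δ := fun n t => hxR n _ (RFDE.max_min_mem_Icc (hrτ n) t)
  have hxX : ∀ n, EqOn (x n) (X n) (Icc (-r) (τ n)) := fun n t ht =>
    (RFDE.stopped_eq (x n) ht).symm
  have hXpos : ∀ n, ∀ t, 0 ≤ t → X n t = x n (min t (τ n)) := fun n t ht => by
    rw [hXdef]
    simp only [RFDE.stopped]
    rw [max_eq_right]
    linarith [le_min ht (hτ n).1.le]
  -- the stopped solutions have a uniform limit `Z`, along a subsequence for which their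
  -- stopping times also converge
  obtain ⟨Z, σ, hσ, hZ, hlim⟩ := RFDE.exists_tendstoUniformly_subseq (a := 0) (b := L) (M := M)
    (X₀ := RFDE.stopped r 0 y) hL.le hXc
    (fun n t ht => by
      have hm := RFDE.max_min_mem_Icc (r := r) (T := 0) (by linarith) t
      have e : min t (τ n) = min t 0 := by
        rw [min_eq_left ht, min_eq_left (ht.trans (hτ n).1.le)]
      simp only [hXdef, RFDE.stopped, e]
      exact hxy0 n _ hm)
    (fun n s hs t ht => by
      have hmem : ∀ u ∈ Icc 0 L, min u (τ n) ∈ Icc 0 (τ n) := fun u hu =>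
        ⟨le_min hu.1 (hτ n).1.le, min_le_right _ _⟩
      rw [hXpos n s hs.1, hXpos n t ht.1]
      refine ((hx n).1.norm_sub_le hr (hgc n) (hτI n) (hxR n)
        (fun t ht => hM _ (div_nonneg ht (hε n).le)) (hmem s hs) (hmem t ht)).trans ?_
      have hmin := abs_min_sub_min_le_max s (τ n) t (τ n)
      rw [sub_self, abs_zero, max_eq_left (abs_nonneg _)] at hmin
      exact mul_le_mul_of_nonneg_left hmin hM0)
    (fun n t ht => by
      rw [hXpos n t (hL.le.trans ht), hXpos n L hL.le, min_eq_right ((hτ n).2.trans ht),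
        min_eq_right (hτ n).2])
  obtain ⟨T, hT, σ', hσ', hτlim⟩ := isCompact_Icc.tendsto_subseq (x := fun n => τ (σ n))
    (s := Icc 0 L) fun n => ⟨(hτ _).1.le, (hτ _).2⟩
  set κ := fun n => σ (σ' n) with hκ
  have hκt : Tendsto κ atTop atTop := hσ.tendsto_atTop.comp hσ'.tendsto_atTop
  have hlim' : TendstoUniformly (fun n => X (κ n)) Z atTop := fun u hu =>
    hσ'.tendsto_atTop.eventually (hlim u hu)
  have hτlim' : Tendsto (fun n => τ (κ n)) atTop (𝓝 T) := hτlim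
  have hZ0 : ∀ t ∈ Icc (-r) 0, Z t = y t := fun t ht => by
    refine tendsto_nhds_unique (hlim'.tendsto_at t) ?_
    have : ∀ n, X n t = y t := fun n => by
      rw [← hxX n ⟨ht.1, ht.2.trans (hτ n).1.le⟩, hxy0 n t ht]
    simp [this]
  have hZT : ‖Z T - y T‖ = δ := by
    have hYc := RFDE.continuous_stopped hrL hyc
    have hT' : T ∈ Icc (-r) L := ⟨by linarith [hT.1], hT.2⟩
    have l₁ : Tendsto (fun n => X (κ n) (τ (κ n))) atTop (𝓝 (Z T)) :=
      hlim'.tendsto_comp hZ.continuousAt hτlim'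
    have l₂ := (hYc.tendsto T).comp hτlim'
    rw [RFDE.stopped_eq y hT'] at l₂
    refine tendsto_nhds_unique (l₁.sub l₂).norm ?_
    have : ∀ n, ‖X n (τ n) - RFDE.stopped r L y (τ n)‖ = δ := fun n => by
      rw [← hxX n ⟨hrτ n, le_rfl⟩, RFDE.stopped_eq y ⟨hrτ n, (hτ n).2⟩, hτeq]
    simp [this]
  have hT0 : 0 < T := by
    refine hT.1.lt_of_ne fun h => hδ.ne ?_
    rw [← hZT, ← h, hZ0 0 ⟨by linarith, le_rfl⟩]
    simp
  -- the limit solves the averaged problem on `[-r, T]`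
  have hFc : ContinuousOn (Function.uncurry fun (_ : ℝ) ψ => F ψ)
      (Ici 0 ×ˢ (univ : Set C(Icc (-r) 0, E))) :=
    ((RFDE.continuous_average hf h3 h1).comp continuous_snd).continuousOn
  have hsol : RFDE.IsSolution r (fun _ ψ => F ψ) φ (Icc (-r) T) Z := by
    refine RFDE.isSolution_of_integral_eq hr hFc hZ hT0
      (fun θ => (hZ0 θ θ.2).trans (hy.1.initial θ)) (RFDE.integral_eq_Icc_of_Ico hFc hZ hT0 ?_)
    intro t ht
    refine tendsto_nhds_unique (hlim'.tendsto_at t) ?_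
    have hav := RFDE.tendsto_integral_rescaled_of_tendsto hf h3 h1 (fun n => hε (κ n))
      (hε0.comp hκt) (H := fun n => RFDE.history r (X (κ n))) (H₀ := RFDE.history r Z)
      (fun n => RFDE.continuous_history (hXc _)) (RFDE.continuous_history hZ)
      (fun s => RFDE.tendsto_history (fun n => hXc _) hZ hlim' tendsto_const_nhds)
      (fun n s t ht => hM t ht _ (RFDE.norm_history_le (hXc _) (by positivity) (hXR _) s)) ht.1
    refine ((hlim'.tendsto_at 0).add hav).congr' ?_
    filter_upwards [hτlim'.eventually (lt_mem_nhds ht.2)] with n hn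
    exact ((hx (κ n)).1.integral_eq (hgc _) (hXc _) (hτsub _) (hxX _) hr ⟨ht.1, hn.le⟩).symm
  have hend := h6.2 _ _ _ _ hsol hy.1
    ⟨⟨by linarith, le_rfl⟩, hyJ ⟨by linarith [hT.1], hT.2⟩⟩
  rw [hend, sub_self, norm_zero] at hZT
  exact hδ.ne hZT
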